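/- Let $M$ be a smooth manifold of dimension $2n+1$. An almost paracontact metric structure $(\phi,\xi,\eta,g)$ on $M$ consists of a smooth $(1,1)$-tensor field $\phi$, a smooth vector field $\xi$, a smooth $1$-form $\eta$ and a pseudo-Riemannian metric $g$ of signature $(n+1,n)$ such that $\eta(\xi)=1$, $\phi^2=\mathrm{Id}-\eta\otimes\xi$, the eigendistributions of $\phi|_{\ker\eta}$ for the eigenvalues $+1$ and $-1$ both have dimension $n$, and $g(\phi X,\phi Y)=-g(X,Y)+\eta(X)\eta(Y)$. Put $\Phi(X,Y)=g(\phi X,Y)$. For a smooth function $\alpha$ on $M$, the structure is called almost $\alpha$-paracosymplectic if $d\eta=0$ and $d\Phi=2\alpha\,\eta\wedge\Phi$. Let $\nabla$ be the Levi-Civita connection of $g$, $R(X,Y)Z=\nabla_X\nabla_YZ-\nabla_Y\nabla_XZ-\nabla_{[X,Y]}Z$ its curvature, $h=\tfrac12\mathcal L_\xi\phi$, and $\phi h=\phi\circ h$, so that $(\nabla_X\phi h)Y=\nabla_X(\phi hY)-\phi h(\nabla_XY)$. Theorem. Let $(M^{2n+1},\phi,\xi,\eta,g)$ be an almost $\alpha$-paracosymplectic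 manifold. Then for all smooth vector fields $X,Y$ on $M$, $$R(X,Y)\xi = d\alpha(X)(Y-\eta(Y)\xi)-d\alpha(Y)(X-\eta(X)\xi)+\alpha\,\eta(X)(\alpha Y+\phi hY)-\alpha\,\eta(Y)(\alpha X+\phi hX)+(\nabla_X\phi h)Y-(\nabla_Y\phi h)X .$$ If moreover $n\ge 2$, then for all smooth vector fields $X,Y$ on $M$, $$R(X,Y)\xi=(f+\alpha^2)(\eta(X)Y-\eta(Y)X)+\alpha(\eta(X)\phi hY-\eta(Y)\phi hX)+(\nabla_X\phi h)Y-(\nabla_Y\phi h)X,\qquad f=\xi(\alpha)=d\alpha(\xi).$$ -/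

import Mathlib

open Bundle VectorField
open scoped Manifold ContDiff

set_option linter.unusedSectionVars false

noncomputable section

namespace ParaGeom

section Metric

variable {E : Type*} [NormedAddCommGroup E] [NormedSpace ℝ E]
  {H : Type*} [TopologicalSpace H] {I : ModelWithCorners ℝ E H}
  {M : Type*} [TopologicalSpace M] [ChartedSpace H M] [IsManifold I ∞ M]

/-- Smoothness at `x` of a vector field defined near `x`. -/
def SmoothFieldAt (X : Π x : M, TangentSpace I x) (x : M) : Prop := CMDiffAt ∞ (T% X) x

/-- Smooth vector fields on `M`. -/
def SmoothField (X : Π x : M, TangentSpace I x) : Prop := CMDiff ∞ (T% X)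

variable (I M) in
/-- A smooth pseudo-Riemannian metric on `M`: a smooth field of nondegenerate symmetric bilinear
forms on the tangent spaces (of no prescribed signature). -/
structure PseudoRiemannianMetric where
  /-- the bilinear form on each tangent space -/
  inner (x : M) : TangentSpace I x →L[ℝ] TangentSpace I x →L[ℝ] ℝ
  symm (x : M) (v w : TangentSpace I x) : inner x v w = inner x w v
  nondegenerate (x : M) (v : TangentSpace I x) (hv : ∀ w, inner x v w = 0) : v = 0
  contMDiff : ContMDiff I (I.prod 𝓘(ℝ, E →L[ℝ] E →L[ℝ] ℝ)) ∞
    (fun x ↦ TotalSpace.mk' (E →L[ℝ] E →L[ℝ] ℝ) x (inner x))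

namespace PseudoRiemannianMetric

variable (g : PseudoRiemannianMetric I M)

/-- The function `g(X, Y)` on `M`, for vector fields `X`, `Y`. -/
def pair (X Y : Π x : M, TangentSpace I x) : M → ℝ := fun x ↦ g.inner x (X x) (Y x)

theorem pair_comm (X Y : Π x : M, TangentSpace I x) : g.pair X Y = g.pair Y X :=
  funext fun x ↦ g.symm x _ _

theorem pair_mdifferentiableAt {X Y : Π x : M, TangentSpace I x} {x : M}
    (hX : MDiffAt (T% X) x) (hY : MDiffAt (T% Y) x) : MDiffAt (g.pair X Y) x := by
  have : MDifferentiableAt I (I.prod 𝓘(ℝ))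
      (fun m ↦ TotalSpace.mk' ℝ (E := Bundle.Trivial M ℝ) m (g.inner m (X m) (Y m))) x := by
    apply MDifferentiableAt.clm_bundle_apply₂ (F₁ := E) (F₂ := E)
    · exact g.contMDiff.mdifferentiableAt (by simp)
    · exact hX
    · exact hY
  simp only [mdifferentiableAt_totalSpace] at this
  exact this.2

theorem pair_smul_left (f : M → ℝ) (X Y : Π x : M, TangentSpace I x) :
    g.pair (f • X) Y = fun x ↦ f x * g.pair X Y x := by
  funext x; simp [pair]

theorem pair_add_left (X X' Y : Π x : M, TangentSpace I x) :
    g.pair (X + X') Y = fun x ↦ g.pair X Y x + g.pair X' Y x := by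
  funext x; simp [pair]

theorem pair_smul_right (f : M → ℝ) (X Y : Π x : M, TangentSpace I x) :
    g.pair X (f • Y) = fun x ↦ f x * g.pair X Y x := by
  funext x; simp [pair]

theorem pair_add_right (X Y Y' : Π x : M, TangentSpace I x) :
    g.pair X (Y + Y') = fun x ↦ g.pair X Y x + g.pair X Y' x := by
  funext x; simp [pair]

/-- The right hand side of the Koszul formula: for the Levi-Civita connection `∇` of `g` one has
`g(∇_X Y, Z) = koszul g Y X Z`. -/
def koszul (Y X Z : Π x : M, TangentSpace I x) (x : M) : ℝ :=
  (1 / 2 : ℝ) *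
    (mvfderiv I (g.pair Y Z) x (X x) + mvfderiv I (g.pair X Z) x (Y x)
      - mvfderiv I (g.pair X Y) x (Z x)
      + g.inner x (mlieBracket I X Y x) (Z x)
      - g.inner x (mlieBracket I X Z x) (Y x)
      - g.inner x (mlieBracket I Y Z x) (X x))

variable [FiniteDimensional ℝ E]

theorem koszul_tensorialAt_left {Y Z : Π x : M, TangentSpace I x} {x : M}
    (hY : MDiffAt (T% Y) x) (hZ : MDiffAt (T% Z) x) :
    TensorialAt I E (fun X ↦ g.koszul Y X Z x) x where
  smul {f X} hf hX := by
    simp only [koszul, pair_smul_left]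
    rw [mvfderiv_fun_mul hf (g.pair_mdifferentiableAt hX hZ),
      mvfderiv_fun_mul hf (g.pair_mdifferentiableAt hX hY),
      mlieBracket_smul_left hf hX, mlieBracket_smul_left hf hX]
    simp [pair]
    rw [g.symm x (mlieBracket I Y Z x) (X x)]
    ring
  add {X X'} hX hX' := by
    simp only [koszul, pair_add_left]
    rw [mvfderiv_fun_add (g.pair_mdifferentiableAt hX hZ) (g.pair_mdifferentiableAt hX' hZ),
      mvfderiv_fun_add (g.pair_mdifferentiableAt hX hY) (g.pair_mdifferentiableAt hX' hY),
      mlieBracket_add_left hX hX', mlieBracket_add_left hX hX']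
    simp
    ring

theorem koszul_tensorialAt_right {Y X : Π x : M, TangentSpace I x} {x : M}
    (hY : MDiffAt (T% Y) x) (hX : MDiffAt (T% X) x) :
    TensorialAt I E (fun Z ↦ g.koszul Y X Z x) x where
  smul {f Z} hf hZ := by
    simp only [koszul, pair_smul_right]
    rw [mvfderiv_fun_mul hf (g.pair_mdifferentiableAt hX hZ),
      mvfderiv_fun_mul hf (g.pair_mdifferentiableAt hY hZ),
      mlieBracket_smul_right hf hZ, mlieBracket_smul_right hf hZ]
    simp [pair]
    rw [g.symm x (Z x) (X x), g.symm x (Z x) (Y x)]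
    ring
  add {Z Z'} hZ hZ' := by
    simp only [koszul, pair_add_right]
    rw [mvfderiv_fun_add (g.pair_mdifferentiableAt hX hZ) (g.pair_mdifferentiableAt hX hZ'),
      mvfderiv_fun_add (g.pair_mdifferentiableAt hY hZ) (g.pair_mdifferentiableAt hY hZ'),
      mlieBracket_add_right hZ hZ', mlieBracket_add_right hZ hZ']
    simp
    ring

theorem koszul_smul {f : M → ℝ} {Y X Z : Π x : M, TangentSpace I x} {x : M} (hf : MDiffAt f x)
    (hY : MDiffAt (T% Y) x) (hX : MDiffAt (T% X) x) (hZ : MDiffAt (T% Z) x) :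
    g.koszul (f • Y) X Z x = f x * g.koszul Y X Z x
      + mvfderiv I f x (X x) * g.inner x (Y x) (Z x) := by
  simp only [koszul, pair_smul_right, pair_smul_left]
  rw [mvfderiv_fun_mul hf (g.pair_mdifferentiableAt hY hZ),
    mvfderiv_fun_mul hf (g.pair_mdifferentiableAt hX hY),
    mlieBracket_smul_right hf hY, mlieBracket_smul_left hf hY]
  simp [pair]
  rw [g.symm x (Y x) (X x)]
  ring

theorem koszul_add {Y Y' X Z : Π x : M, TangentSpace I x} {x : M}
    (hY : MDiffAt (T% Y) x) (hY' : MDiffAt (T% Y') x)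
    (hX : MDiffAt (T% X) x) (hZ : MDiffAt (T% Z) x) :
    g.koszul (Y + Y') X Z x = g.koszul Y X Z x + g.koszul Y' X Z x := by
  simp only [koszul, pair_add_right, pair_add_left]
  rw [mvfderiv_fun_add (g.pair_mdifferentiableAt hY hZ) (g.pair_mdifferentiableAt hY' hZ),
    mvfderiv_fun_add (g.pair_mdifferentiableAt hX hY) (g.pair_mdifferentiableAt hX hY'),
    mlieBracket_add_right hY hY', mlieBracket_add_left hY hY']
  simp
  ring

/-- The Koszul expression of a vector field `Y` differentiable at `x`, as a bilinear form in the
values `X x`, `Z x`. -/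
def koszulForm (Y : Π x : M, TangentSpace I x) (x : M) (hY : MDiffAt (T% Y) x) :
    TangentSpace I x →L[ℝ] TangentSpace I x →L[ℝ] ℝ :=
  TensorialAt.mkHom₂ (fun X Z ↦ g.koszul Y X Z x) x
    (fun _ hZ ↦ g.koszul_tensorialAt_left hY hZ) (fun _ hX ↦ g.koszul_tensorialAt_right hY hX)

theorem koszulForm_apply {Y X Z : Π x : M, TangentSpace I x} {x : M} (hY : MDiffAt (T% Y) x)
    (hX : MDiffAt (T% X) x) (hZ : MDiffAt (T% Z) x) :
    g.koszulForm Y x hY (X x) (Z x) = g.koszul Y X Z x :=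
  TensorialAt.mkHom₂_apply _ _ hX hZ

/-- The isomorphism `v ↦ g(v, ·)` of a tangent space with its dual. -/
def flat (x : M) : TangentSpace I x ≃ₗ[ℝ] Module.Dual ℝ (TangentSpace I x) :=
  have : FiniteDimensional ℝ (TangentSpace I x) := inferInstanceAs (FiniteDimensional ℝ E)
  LinearEquiv.ofInjectiveOfFinrankEq
    ({ toFun := fun v ↦ (g.inner x v).toLinearMap
       map_add' := fun v w ↦ by ext; simp
       map_smul' := fun c v ↦ by ext; simp } :
      TangentSpace I x →ₗ[ℝ] Module.Dual ℝ (TangentSpace I x))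
    ((injective_iff_map_eq_zero _).2 fun v hv ↦
      g.nondegenerate x v fun w ↦ congrArg (fun l : Module.Dual ℝ (TangentSpace I x) ↦ l w) hv)
    Subspace.dual_finrank_eq.symm

theorem flat_apply (x : M) (v w : TangentSpace I x) : g.flat x v w = g.inner x v w := rfl

theorem inner_flat_symm (x : M) (l : Module.Dual ℝ (TangentSpace I x)) (w : TangentSpace I x) :
    g.inner x ((g.flat x).symm l) w = l w := by
  rw [← flat_apply, LinearEquiv.apply_symm_apply]

theorem ext_inner {x : M} {v v' : TangentSpace I x}
    (h : ∀ w, g.inner x v w = g.inner x v' w) : v = v' :=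
  sub_eq_zero.1 (g.nondegenerate x _ fun w ↦ by simp [h w])

open scoped Classical in
/-- The Levi-Civita connection on vector fields, defined by the Koszul formula. As in Mathlib,
`leviCivitaFun g Y x (X x)` is `(∇_X Y)(x)`, and the value is `0` where `Y` is not
differentiable. -/
def leviCivitaFun (Y : Π x : M, TangentSpace I x) (x : M) :
    TangentSpace I x →L[ℝ] TangentSpace I x :=
  if hY : MDiffAt (T% Y) x then
    have : FiniteDimensional ℝ (TangentSpace I x) := inferInstanceAs (FiniteDimensional ℝ E)
    have : T2Space (TangentSpace I x) := inferInstanceAs (T2Space E)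
    LinearMap.toContinuousLinearMap
      { toFun := fun v ↦ (g.flat x).symm (g.koszulForm Y x hY v).toLinearMap
        map_add' := fun v w ↦ by
          rw [← map_add]; congr 1; ext; simp
        map_smul' := fun c v ↦ by
          rw [RingHom.id_apply, ← map_smul]; congr 1; ext; simp }
  else 0

theorem inner_leviCivitaFun {Y : Π x : M, TangentSpace I x} {x : M} (hY : MDiffAt (T% Y) x)
    (v w : TangentSpace I x) :
    g.inner x (g.leviCivitaFun Y x v) w = g.koszulForm Y x hY v w := by
  rw [leviCivitaFun, dif_pos hY]
  exact g.inner_flat_symm x _ w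

/-- The Koszul formula `g(∇_X Y, Z) = koszul g Y X Z`. -/
theorem inner_leviCivitaFun_apply {Y X Z : Π x : M, TangentSpace I x} {x : M}
    (hY : MDiffAt (T% Y) x) (hX : MDiffAt (T% X) x) (hZ : MDiffAt (T% Z) x) :
    g.inner x (g.leviCivitaFun Y x (X x)) (Z x) = g.koszul Y X Z x := by
  rw [g.inner_leviCivitaFun hY, g.koszulForm_apply hY hX hZ]

/-- To identify `∇ Y` at `x` it suffices to test against fields differentiable at `x`. -/
theorem ext_clm {x : M} {A B : TangentSpace I x →L[ℝ] TangentSpace I x}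
    (h : ∀ X Z : Π x : M, TangentSpace I x, MDiffAt (T% X) x → MDiffAt (T% Z) x →
      g.inner x (A (X x)) (Z x) = g.inner x (B (X x)) (Z x)) : A = B := by
  ext v
  refine g.ext_inner fun w ↦ ?_
  simpa using h (FiberBundle.extend E v) (FiberBundle.extend E w)
    (FiberBundle.mdifferentiableAt_extend ..) (FiberBundle.mdifferentiableAt_extend ..)

/-- The Levi-Civita connection of a pseudo-Riemannian metric. -/
def leviCivita : CovariantDerivative I E (TangentSpace I : M → Type _) where
  toFun := g.leviCivitaFun
  isCovariantDerivativeOnUniv :=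
    { add := fun {Y Y' x} hY hY' _ ↦ by
        refine g.ext_clm fun X Z hX hZ ↦ ?_
        have hs : MDiffAt (T% (Y + Y')) x := mdifferentiableAt_add_section hY hY'
        simp [g.inner_leviCivitaFun_apply hs hX hZ, g.inner_leviCivitaFun_apply hY hX hZ,
          g.inner_leviCivitaFun_apply hY' hX hZ, g.koszul_add hY hY' hX hZ]
      leibniz := fun {Y f x} hY hf _ ↦ by
        refine g.ext_clm fun X Z hX hZ ↦ ?_
        have hs : MDiffAt (T% (f • Y)) x := hf.smul_section hY
        simp [g.inner_leviCivitaFun_apply hs hX hZ, g.inner_leviCivitaFun_apply hY hX hZ,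
          g.koszul_smul hf hY hX hZ] }

/-- The covariant derivative `∇_X Y` of vector fields, for the Levi-Civita connection. -/
def nabla (X Y : Π x : M, TangentSpace I x) : Π x : M, TangentSpace I x :=
  fun x ↦ g.leviCivita Y x (X x)

/-- The Levi-Civita connection is torsion free. -/
theorem nabla_torsion_free {X Y : Π x : M, TangentSpace I x} {x : M}
    (hX : MDiffAt (T% X) x) (hY : MDiffAt (T% Y) x) :
    g.nabla X Y x - g.nabla Y X x = mlieBracket I X Y x := by
  refine g.ext_inner fun w ↦ ?_
  have hZ : MDiffAt (T% (FiberBundle.extend E w : Π x : M, TangentSpace I x)) x :=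
    FiberBundle.mdifferentiableAt_extend ..
  have h1 := g.inner_leviCivitaFun_apply hY hX hZ
  have h2 := g.inner_leviCivitaFun_apply hX hY hZ
  simp only [FiberBundle.extend_apply_self] at h1 h2
  change g.inner x (g.leviCivitaFun Y x (X x) - g.leviCivitaFun X x (Y x)) w = _
  rw [map_sub, sub_apply, h1, h2]
  simp only [koszul, FiberBundle.extend_apply_self, g.pair_comm Y X,
    mlieBracket_swap_apply (V := Y) (W := X)]
  simp
  ring

/-- The Levi-Civita connection is metric. -/
theorem nabla_metric {X Y Z : Π x : M, TangentSpace I x} {x : M}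
    (hX : MDiffAt (T% X) x) (hY : MDiffAt (T% Y) x) (hZ : MDiffAt (T% Z) x) :
    mvfderiv I (g.pair Y Z) x (X x) =
      g.inner x (g.nabla X Y x) (Z x) + g.inner x (Y x) (g.nabla X Z x) := by
  have h1 := g.inner_leviCivitaFun_apply hY hX hZ
  have h2 := g.inner_leviCivitaFun_apply hZ hX hY
  change _ = g.inner x (g.leviCivitaFun Y x (X x)) (Z x)
    + g.inner x (Y x) (g.leviCivitaFun Z x (X x))
  rw [g.symm x (Y x), h1, h2]
  simp only [koszul, g.pair_comm Z Y, mlieBracket_swap_apply (V := Z) (W := Y)]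
  simp
  ring

/-- The Riemann curvature `R(X, Y)Z = ∇_X ∇_Y Z - ∇_Y ∇_X Z - ∇_[X,Y] Z`. -/
def curvature (X Y Z : Π x : M, TangentSpace I x) : Π x : M, TangentSpace I x :=
  g.nabla X (g.nabla Y Z) - g.nabla Y (g.nabla X Z) - g.nabla (mlieBracket I X Y) Z

/-- The covariant derivative `(∇_X T)Y = ∇_X (T Y) - T (∇_X Y)` of a (1,1)-tensor field `T`. -/
def nablaEnd (T : Π x : M, TangentSpace I x →L[ℝ] TangentSpace I x)
    (X Y : Π x : M, TangentSpace I x) : Π x : M, TangentSpace I x :=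
  fun x ↦ g.nabla X (fun p ↦ T p (Y p)) x - T x (g.nabla X Y x)

end PseudoRiemannianMetric

/-- The exterior derivative of a 1-form, evaluated on vector fields (convention with the factor
`1/2`). -/
def extDerivOne (η : Π x : M, TangentSpace I x →L[ℝ] ℝ)
    (X Y : Π x : M, TangentSpace I x) (x : M) : ℝ :=
  (1 / 2 : ℝ) * (mvfderiv I (fun p ↦ η p (Y p)) x (X x) - mvfderiv I (fun p ↦ η p (X p)) x (Y x)
    - η x (mlieBracket I X Y x))

/-- The exterior derivative of a 2-form, evaluated on vector fields (convention with the factor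
`1/3`). -/
def extDerivTwo (Φ : Π x : M, TangentSpace I x →L[ℝ] TangentSpace I x →L[ℝ] ℝ)
    (X Y Z : Π x : M, TangentSpace I x) (x : M) : ℝ :=
  (1 / 3 : ℝ) *
    (mvfderiv I (fun p ↦ Φ p (Y p) (Z p)) x (X x)
      + mvfderiv I (fun p ↦ Φ p (Z p) (X p)) x (Y x)
      + mvfderiv I (fun p ↦ Φ p (X p) (Y p)) x (Z x)
      - Φ x (mlieBracket I X Y x) (Z x) - Φ x (mlieBracket I Y Z x) (X x)
      - Φ x (mlieBracket I Z X x) (Y x))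

/-- The wedge product of a 1-form and a 2-form at a point (convention with the factor `1/3`, the
same as for the exterior derivative). -/
def wedgeOneTwo {x : M} (η : TangentSpace I x →L[ℝ] ℝ)
    (Φ : TangentSpace I x →L[ℝ] TangentSpace I x →L[ℝ] ℝ) (u v w : TangentSpace I x) : ℝ :=
  (1 / 3 : ℝ) * (η u * Φ v w + η v * Φ w u + η w * Φ u v)

end Metric

section Paracontact

variable {E : Type*} [NormedAddCommGroup E] [NormedSpace ℝ E]
  {H : Type*} [TopologicalSpace H] (I : ModelWithCorners ℝ E H)
  (M : Type*) [TopologicalSpace M] [ChartedSpace H M] [IsManifold I ∞ M] (n : ℕ)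

/-- An almost paracontact metric structure `(φ, ξ, η, g)` on a smooth manifold `M` of dimension
`2n + 1`, modelled on `I`. -/
structure AlmostParacontactMetricStructure where
  /-- the (1,1)-tensor field -/
  φ (x : M) : TangentSpace I x →L[ℝ] TangentSpace I x
  /-- the characteristic vector field -/
  ξ (x : M) : TangentSpace I x
  /-- the 1-form -/
  η (x : M) : TangentSpace I x →L[ℝ] ℝ
  /-- the pseudo-Riemannian metric -/
  g : PseudoRiemannianMetric I M
  φ_smooth : ContMDiff I (I.prod 𝓘(ℝ,
      E →L[ℝ] E)) ∞
    (fun x ↦ TotalSpace.mk'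
      (E →L[ℝ] E) x (φ x))
  ξ_smooth : CMDiff ∞ (T% ξ)
  η_smooth : ContMDiff I (I.prod 𝓘(ℝ,
      E →L[ℝ] ℝ)) ∞
    (fun x ↦ TotalSpace.mk' (E →L[ℝ] ℝ) x (η x))
  η_ξ (x : M) : η x (ξ x) = 1
  φ_sq (x : M) (v : TangentSpace I x) : φ x (φ x v) = v - η x v • ξ x
  /-- the eigendistributions of `φ` on `ker η` for the eigenvalues `1` and `-1` have dimension
  `n` -/
  finrank_pos (x : M) : Module.finrank ℝ
    (Module.End.eigenspace (φ x).toLinearMap 1 ⊓ (η x).toLinearMap.ker : Submodule ℝ _) = n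
  finrank_neg (x : M) : Module.finrank ℝ
    (Module.End.eigenspace (φ x).toLinearMap (-1) ⊓ (η x).toLinearMap.ker : Submodule ℝ _) = n
  /-- `g` has signature `(n + 1, n)` -/
  signature (x : M) : ∃ b : Module.Basis (Fin (n + 1) ⊕ Fin n) ℝ (TangentSpace I x),
    ∀ i j, g.inner x (b i) (b j) = if i = j then Sum.elim (fun _ ↦ 1) (fun _ ↦ -1) i else 0
  compat (x : M) (v w : TangentSpace I x) :
    g.inner x (φ x v) (φ x w) = - g.inner x v w + η x v * η x w

namespace AlmostParacontactMetricStructure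

variable {I M n} (S : AlmostParacontactMetricStructure I M n)

/-- The fundamental 2-form `Φ(X, Y) = g(φX, Y)`. -/
def fundamentalForm (x : M) :
    TangentSpace I x →L[ℝ] TangentSpace I x →L[ℝ] ℝ :=
  (S.g.inner x).comp (S.φ x)

theorem φ_mdifferentiableAt {Y : Π x : M, TangentSpace I x} {x : M}
    (hY : MDiffAt (T% Y) x) :
    MDiffAt (T% (fun p ↦ S.φ p (Y p) : Π x : M, TangentSpace I x)) x :=
  MDifferentiableAt.clm_bundle_apply (S.φ_smooth.mdifferentiableAt (by simp)) hY

variable [FiniteDimensional ℝ E]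

theorem lieDeriv_φ_tensorialAt (x : M) :
    TensorialAt I E
      (fun Y : Π x : M, TangentSpace I x ↦
        mlieBracket I S.ξ (fun p ↦ S.φ p (Y p)) x
          - S.φ x (mlieBracket I S.ξ Y x)) x where
  smul {f Y} hf hY := by
    have e : (fun p ↦ S.φ p ((f • Y) p) : Π x : M, TangentSpace I x)
        = f • (fun p ↦ S.φ p (Y p)) := by funext p; simp
    simp only [e]
    rw [mlieBracket_smul_right hf (S.φ_mdifferentiableAt hY), mlieBracket_smul_right hf hY]
    simp
    module
  add {Y Y'} hY hY' := by
    have e : (fun p ↦ S.φ p ((Y + Y') p) : Π x : M, TangentSpace I x)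
        = (fun p ↦ S.φ p (Y p)) + (fun p ↦ S.φ p (Y' p)) := by funext p; simp
    simp only [e]
    rw [mlieBracket_add_right (S.φ_mdifferentiableAt hY) (S.φ_mdifferentiableAt hY'),
      mlieBracket_add_right hY hY']
    simp
    abel

/-- The Lie derivative `(L_ξ φ)Y = [ξ, φY] - φ[ξ, Y]`, as a (1,1)-tensor field. -/
def lieDeriv_φ (x : M) : TangentSpace I x →L[ℝ] TangentSpace I x :=
  TensorialAt.mkHom _ x (S.lieDeriv_φ_tensorialAt x)

theorem lieDeriv_φ_apply {Y : Π x : M, TangentSpace I x} {x : M}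
    (hY : MDiffAt (T% Y) x) :
    S.lieDeriv_φ x (Y x) = mlieBracket I S.ξ (fun p ↦ S.φ p (Y p)) x
      - S.φ x (mlieBracket I S.ξ Y x) :=
  TensorialAt.mkHom_apply (S.lieDeriv_φ_tensorialAt x) hY

/-- The tensor field `h = (1/2) L_ξ φ`. -/
def h (x : M) : TangentSpace I x →L[ℝ] TangentSpace I x :=
  (1 / 2 : ℝ) • S.lieDeriv_φ x

/-- The tensor field `φh = φ ∘ h`. -/
def φh (x : M) : TangentSpace I x →L[ℝ] TangentSpace I x :=
  (S.φ x).comp (S.h x)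

/-- The structure is almost `α`-paracosymplectic: `α` is a smooth function, `dη = 0` and
`dΦ = 2α η ∧ Φ`. The identities between forms are tested, at each point, on all vector fields
that are smooth at that point. -/
structure IsAlmostParacosymplectic (α : M → ℝ) : Prop where
  smooth : CMDiff ∞ α
  closed (x : M) (X Y : Π x : M, TangentSpace I x)
    (hX : SmoothFieldAt X x) (hY : SmoothFieldAt Y x) : extDerivOne S.η X Y x = 0
  extDeriv_fundamentalForm (x : M) (X Y Z : Π x : M, TangentSpace I x)
    (hX : SmoothFieldAt X x) (hY : SmoothFieldAt Y x) (hZ : SmoothFieldAt Z x) :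
    extDerivTwo S.fundamentalForm X Y Z x =
      2 * α x * wedgeOneTwo (S.η x) (S.fundamentalForm x) (X x) (Y x) (Z x)

end AlmostParacontactMetricStructure

end Paracontact

end ParaGeom

end

noncomputable section

namespace ParaGeom

open scoped Topology

/-! ### Pointwise algebra and regularity of the structure tensors. -/

section Paracontact

variable {E : Type*} [NormedAddCommGroup E] [NormedSpace ℝ E]
  {H : Type*} [TopologicalSpace H] {I : ModelWithCorners ℝ E H}
  {M : Type*} [TopologicalSpace M] [ChartedSpace H M] [IsManifold I ∞ M] {n : ℕ}

namespace AlmostParacontactMetricStructure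

variable (S : AlmostParacontactMetricStructure I M n)

/-! Everything rests on the formula ∇_X ξ = α φ²X + φhX (`leviCivita_ξ`). Write A for the
endomorphism X ↦ ∇_X ξ. Since g(ξ,ξ) = 1, η ∘ A = 0; since dη = 0, A is g-self-adjoint, and
therefore Aξ = 0. Contracting dΦ = 2α η ∧ Φ with ξ gives ∇_ξ φ = B with B = 2αφ - φA - Aφ.
Differentiating φ² = Id - η ⊗ ξ along ξ shows that ∇_ξ φ anticommutes with φ, whereas B visibly
commutes with φ; as B takes values in ker η, where φ² = Id, it vanishes (`φ_nabla_ξ`).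
Torsion-freeness then gives h = φA - αφ, and applying φ yields the formula. The first curvature
identity follows from it by the Leibniz rule; the terms X(η(Y)) ξ cancel because dη = 0.

For the second identity it is enough that dα = ξ(α) η when n ≥ 2. Applying d to dΦ = 2α η ∧ Φ leaves
dα ∧ η ∧ Φ = 0, because dη = 0 and η ∧ η = 0. This is carried out in a commuting coordinate frame
and contracted with ξ (`mvfderiv_wedge_fundamentalForm`). As Φ is nondegenerate on ker η, of
dimension 2n ≥ 4, dα must vanish there (`mvfderiv_eq`). -/

theorem φ_ξ (x : M) : S.φ x (S.ξ x) = 0 := by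
  have h1 : S.φ x (S.φ x (S.ξ x)) = 0 := by simp [S.φ_sq, S.η_ξ]
  have h2 := S.φ_sq x (S.φ x (S.ξ x))
  rw [h1, map_zero] at h2
  have h3 : S.φ x (S.ξ x) = S.η x (S.φ x (S.ξ x)) • S.ξ x := (sub_eq_zero.1 h2.symm)
  set c := S.η x (S.φ x (S.ξ x)) with hc
  have h4 : c • (c • S.ξ x) = 0 := by
    rw [← h3, ← map_smul, ← h3, h1]
  have h5 := congrArg (S.η x) h4
  simp only [map_smul, S.η_ξ, map_zero, smul_eq_mul, mul_one, mul_self_eq_zero] at h5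
  rw [h3, h5, zero_smul]

/-- Compare the two ways of evaluating φ³v: φ²(φv) = φv - η(φv)ξ and φ(φ²v) = φv. -/
theorem η_φ (x : M) (v : TangentSpace I x) : S.η x (S.φ x v) = 0 := by
  have h1 := S.φ_sq x (S.φ x v)
  rw [S.φ_sq x v, map_sub, map_smul, S.φ_ξ, smul_zero, sub_zero] at h1
  have h2 := congrArg (S.η x) h1
  simpa [S.η_ξ] using h2

theorem inner_ξ (x : M) (v : TangentSpace I x) : S.g.inner x v (S.ξ x) = S.η x v := by
  have h1 := S.compat x v (S.ξ x)
  rw [S.φ_ξ, map_zero, S.η_ξ, mul_one] at h1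
  linarith

theorem inner_φ (x : M) (v w : TangentSpace I x) :
    S.g.inner x (S.φ x v) w = - S.g.inner x v (S.φ x w) := by
  have h1 := S.compat x v (S.φ x w)
  rw [S.φ_sq, S.η_φ, map_sub, map_smul, S.inner_ξ, S.η_φ] at h1
  simpa using h1

theorem pair_ξ (Y : Π x : M, TangentSpace I x) : S.g.pair Y S.ξ = fun p ↦ S.η p (Y p) :=
  funext fun p ↦ S.inner_ξ p (Y p)

theorem ξ_mdifferentiableAt (x : M) : MDiffAt (T% S.ξ) x :=
  S.ξ_smooth.mdifferentiableAt (by simp)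

theorem η_mdifferentiableAt {Y : Π x : M, TangentSpace I x} {x : M}
    (hY : MDiffAt (T% Y) x) : MDiffAt (fun p ↦ S.η p (Y p)) x := by
  rw [← S.pair_ξ]
  exact S.g.pair_mdifferentiableAt hY (S.ξ_mdifferentiableAt x)

theorem φ_smoothAt {Y : Π x : M, TangentSpace I x} {x : M} {k : ℕ∞ω} (hY : CMDiffAt k (T% Y) x)
    (hk : k ≤ ∞ := by exact le_rfl) :
    CMDiffAt k (T% (fun p ↦ S.φ p (Y p) : Π x : M, TangentSpace I x)) x :=
  ContMDiffAt.clm_bundle_apply (S.φ_smooth.contMDiffAt.of_le hk) hY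

theorem fundamentalForm_apply (x : M) (v w : TangentSpace I x) :
    S.fundamentalForm x v w = S.g.inner x (S.φ x v) w := rfl

theorem fundamentalForm_swap (x : M) (v w : TangentSpace I x) :
    S.fundamentalForm x v w = - S.fundamentalForm x w v := by
  rw [fundamentalForm_apply, fundamentalForm_apply, S.inner_φ, S.g.symm]

theorem fundamentalForm_ξ (x : M) (v : TangentSpace I x) :
    S.fundamentalForm x v (S.ξ x) = 0 := by
  rw [fundamentalForm_apply, S.inner_ξ, S.η_φ]

theorem fundamentalForm_smoothAt {Y Z : Π x : M, TangentSpace I x} {x : M}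
    (hY : CMDiffAt ∞ (T% Y) x) (hZ : CMDiffAt ∞ (T% Z) x) :
    CMDiffAt ∞ (fun p ↦ S.fundamentalForm p (Y p) (Z p)) x := by
  have : ContMDiffAt I (I.prod 𝓘(ℝ)) ∞
      (fun m ↦ TotalSpace.mk' ℝ (E := Bundle.Trivial M ℝ) m
        (S.g.inner m (S.φ m (Y m)) (Z m))) x :=
    ContMDiffAt.clm_bundle_apply₂ (F₁ := E) (F₂ := E) S.g.contMDiff.contMDiffAt
      (S.φ_smoothAt hY) hZ
  simp only [contMDiffAt_totalSpace] at this
  exact this.2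

theorem η_smoothAt {Y : Π x : M, TangentSpace I x} {x : M}
    (hY : CMDiffAt ∞ (T% Y) x) : CMDiffAt ∞ (fun p ↦ S.η p (Y p)) x := by
  have : ContMDiffAt I (I.prod 𝓘(ℝ)) ∞
      (fun m ↦ TotalSpace.mk' ℝ (E := Bundle.Trivial M ℝ) m (S.η m (Y m))) x :=
    ContMDiffAt.clm_bundle_apply (F₁ := E) S.η_smooth.contMDiffAt hY
  simp only [contMDiffAt_totalSpace] at this
  exact this.2

/-- Nondegeneracy of Φ on ker η: ξ lies in the radical of Φ, so testing on ker η already gives g(φv,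
·) = 0. Thus φv = 0 and v = φ²v = 0. -/
theorem eq_zero_of_fundamentalForm (x : M) (v : TangentSpace I x) (hη : S.η x v = 0)
    (h : ∀ w, S.η x w = 0 → S.fundamentalForm x v w = 0) : v = 0 := by
  have h1 : S.φ x v = 0 := S.g.nondegenerate x _ fun w ↦ by
    have h2 := h (w - S.η x w • S.ξ x) (by simp [S.η_ξ])
    rwa [map_sub, map_smul, S.fundamentalForm_ξ, smul_zero, sub_zero] at h2
  have h2 := S.φ_sq x v
  rw [h1, map_zero, hη, zero_smul, sub_zero] at h2
  exact h2.symm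

variable [FiniteDimensional ℝ E]

/-! ### The covariant derivative of ξ and the curvature identity. -/

section Connection

variable {S} {α : M → ℝ}

/-- Differentiate the constant function g(ξ, ξ) = 1. -/
theorem η_nabla_ξ {X : Π x : M, TangentSpace I x} {x : M} (hX : MDiffAt (T% X) x) :
    S.η x (S.g.nabla X S.ξ x) = 0 := by
  have h1 := S.g.nabla_metric hX (S.ξ_mdifferentiableAt x) (S.ξ_mdifferentiableAt x)
  rw [S.g.symm x (S.ξ x), S.inner_ξ, S.pair_ξ] at h1
  simp only [S.η_ξ] at h1
  rw [mvfderiv_const] at h1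
  have : (0 : ℝ) = S.η x (S.g.nabla X S.ξ x) + S.η x (S.g.nabla X S.ξ x) := h1
  linarith

/-- For a metric torsion-free connection, 2dη(X,Y) = g(∇_X ξ, Y) - g(X, ∇_Y ξ), because η = g(·, ξ).
-/
theorem IsAlmostParacosymplectic.inner_nabla_ξ_symm (hS : S.IsAlmostParacosymplectic α)
    {X Y : Π x : M, TangentSpace I x} {x : M} (hX : SmoothFieldAt X x) (hY : SmoothFieldAt Y x) :
    S.g.inner x (S.g.nabla X S.ξ x) (Y x) = S.g.inner x (X x) (S.g.nabla Y S.ξ x) := by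
  have hX' : MDiffAt (T% X) x := ContMDiffAt.mdifferentiableAt hX (by simp)
  have hY' : MDiffAt (T% Y) x := ContMDiffAt.mdifferentiableAt hY (by simp)
  have h1 := hS.closed x X Y hX hY
  have h2 := S.g.nabla_metric hX' hY' (S.ξ_mdifferentiableAt x)
  have h3 := S.g.nabla_metric hY' hX' (S.ξ_mdifferentiableAt x)
  rw [extDerivOne, ← S.pair_ξ, ← S.pair_ξ, h2, h3, ← S.g.nabla_torsion_free hX' hY', S.inner_ξ,
    S.inner_ξ, map_sub, S.g.symm x (Y x)] at h1
  linarith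

theorem IsAlmostParacosymplectic.nabla_ξ_ξ (hS : S.IsAlmostParacosymplectic α) (x : M) :
    S.g.nabla S.ξ S.ξ x = 0 := by
  refine S.g.nondegenerate x _ fun w ↦ ?_
  have hX : CMDiffAt ∞ (T% (FiberBundle.extend E w : Π x : M, TangentSpace I x)) x :=
    FiberBundle.contMDiffAt_extend ..
  have h1 := hS.inner_nabla_ξ_symm S.ξ_smooth.contMDiffAt hX
  rw [S.g.symm x (S.ξ x), S.inner_ξ, η_nabla_ξ (hX.mdifferentiableAt (by simp))] at h1
  simpa using h1

/-- Contracting `dΦ = 2α η ∧ Φ` with `ξ` expresses `∇_ξ φ` through `∇ξ`. -/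
theorem IsAlmostParacosymplectic.nabla_ξ_φ (hS : S.IsAlmostParacosymplectic α)
    {X : Π x : M, TangentSpace I x} {x : M} (hX : SmoothFieldAt X x) :
    S.g.nabla S.ξ (fun p ↦ S.φ p (X p)) x - S.φ x (S.g.nabla S.ξ X x) =
      (2 * α x) • S.φ x (X x) - S.φ x (S.g.nabla X S.ξ x)
        - S.g.nabla (fun p ↦ S.φ p (X p)) S.ξ x := by
  refine S.g.ext_inner fun w ↦ ?_
  obtain ⟨Y, hY, rfl⟩ : ∃ Y : Π x : M, TangentSpace I x, SmoothFieldAt Y x ∧ Y x = w :=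
    ⟨FiberBundle.extend E w, FiberBundle.contMDiffAt_extend .., by simp⟩
  have hX' : MDiffAt (T% X) x := ContMDiffAt.mdifferentiableAt hX (by simp)
  have hY' : MDiffAt (T% Y) x := ContMDiffAt.mdifferentiableAt hY (by simp)
  have hξ := S.ξ_mdifferentiableAt x
  have h0 := hS.extDeriv_fundamentalForm x S.ξ X Y S.ξ_smooth.contMDiffAt hX hY
  have e1 : (fun p ↦ S.fundamentalForm p (X p) (Y p)) = S.g.pair (fun p ↦ S.φ p (X p)) Y := rfl
  have e2 : (fun p ↦ S.fundamentalForm p (Y p) (S.ξ p)) = fun _ ↦ 0 :=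
    funext fun p ↦ S.fundamentalForm_ξ p _
  have e3 : (fun p ↦ S.fundamentalForm p (S.ξ p) (X p)) = fun _ ↦ 0 :=
    funext fun p ↦ by rw [fundamentalForm_swap, S.fundamentalForm_ξ, neg_zero]
  have e4 (v : TangentSpace I x) : S.fundamentalForm x (S.ξ x) v = 0 := by
    rw [fundamentalForm_swap, S.fundamentalForm_ξ, neg_zero]
  rw [extDerivTwo, wedgeOneTwo, e1, e2, e3, mvfderiv_const,
    S.g.nabla_metric hξ (S.φ_mdifferentiableAt hX') hY', S.fundamentalForm_ξ,
    S.fundamentalForm_ξ, e4, S.η_ξ, ← S.g.nabla_torsion_free hξ hX',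
    ← S.g.nabla_torsion_free hY' hξ] at h0
  -- Self-adjointness of ∇ξ moves the derivative off the test field: g(φX, ∇_Y ξ) becomes g(∇_{φX}
  -- ξ, Y).
  have h1 := hS.inner_nabla_ξ_symm (X := fun p ↦ S.φ p (X p)) (Y := Y) (S.φ_smoothAt hX) hY
  simp only [fundamentalForm_apply, map_sub, sub_apply, map_smul, smul_apply, smul_eq_mul] at h0 ⊢
  have h2 := S.inner_φ x (X x) (S.g.nabla S.ξ Y x)
  have h3 := S.inner_φ x (S.g.nabla Y S.ξ x) (X x)
  have h4 := S.inner_φ x (S.g.nabla S.ξ Y x) (X x)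
  rw [S.g.symm x _ (S.φ x (X x))] at h3 h4
  simp at h0
  linarith

/-- The right side of `nabla_ξ_φ` commutes with φ, while ∇_ξ φ anticommutes with it; hence both
sides vanish. Equivalently, ∇_ξ φ = 0. -/
theorem IsAlmostParacosymplectic.φ_nabla_ξ (hS : S.IsAlmostParacosymplectic α)
    {X : Π x : M, TangentSpace I x} {x : M} (hX : SmoothFieldAt X x) :
    S.φ x (S.g.nabla X S.ξ x) + S.g.nabla (fun p ↦ S.φ p (X p)) S.ξ x =
      (2 * α x) • S.φ x (X x) := by
  have hX' : MDiffAt (T% X) x := ContMDiffAt.mdifferentiableAt hX (by simp)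
  have h1 := hS.nabla_ξ_φ hX
  have h2 := hS.nabla_ξ_φ (X := fun p ↦ S.φ p (X p)) (S.φ_smoothAt hX)
  have hξ := S.ξ_mdifferentiableAt x
  have hη := S.η_mdifferentiableAt hX'
  have e1 : (fun p ↦ S.φ p (S.φ p (X p)))
      = X + (fun p ↦ -S.η p (X p)) • S.ξ := by
    funext p
    simp only [S.φ_sq, Pi.add_apply, Pi.smul_apply', neg_smul, sub_eq_add_neg]
  -- Since ∇_ξ ξ = 0, the correction to ∇_ξ X is a multiple of ξ, which φ kills below.
  have e2 : S.g.nabla S.ξ (fun p ↦ S.φ p (S.φ p (X p))) x =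
      S.g.nabla S.ξ X x - mvfderiv I (fun p ↦ S.η p (X p)) x (S.ξ x) • S.ξ x := by
    have h3 : S.g.leviCivita S.ξ x (S.ξ x) = 0 := hS.nabla_ξ_ξ x
    have h4 : MDiffAt (fun p ↦ -S.η p (X p)) x := hη.neg
    have h5 : mvfderiv I (fun p ↦ -S.η p (X p)) x = - mvfderiv I (fun p ↦ S.η p (X p)) x :=
      mvfderiv_neg
    rw [e1, PseudoRiemannianMetric.nabla,
      S.g.leviCivita.isCovariantDerivativeOnUniv.add hX' (h4.smul_section hξ),
      S.g.leviCivita.isCovariantDerivativeOnUniv.leibniz hξ h4, h5]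
    simp [h3, PseudoRiemannianMetric.nabla, sub_eq_add_neg]
  have e3 : S.g.nabla (fun p ↦ S.φ p (S.φ p (X p))) S.ξ x = S.g.nabla X S.ξ x := by
    have h3 : S.g.leviCivita S.ξ x (S.ξ x) = 0 := hS.nabla_ξ_ξ x
    simp only [PseudoRiemannianMetric.nabla, S.φ_sq, map_sub, map_smul, h3, smul_zero, sub_zero]
  rw [e2, e3] at h2
  -- With B as above these are φ²(∇_ξ φ)X = φ²BX and φ(∇_ξ φ)φX = φBφX: the left sides add up to 0,
  -- the right sides to 2BX.
  have h3 := congrArg (S.φ x) (congrArg (S.φ x) h1)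
  have h4 := congrArg (S.φ x) h2
  have h5 := η_nabla_ξ (S := S) hX'
  have h6 := η_nabla_ξ (S := S) (S.φ_mdifferentiableAt hX')
  simp only [map_sub, map_smul, S.φ_sq, S.φ_ξ, h5, h6, smul_zero, zero_smul,
    sub_zero] at h3 h4
  have h7 : (2 : ℝ) • (S.φ x (S.g.nabla X S.ξ x) + S.g.nabla (fun p ↦ S.φ p (X p)) S.ξ x) =
      (2 : ℝ) • ((2 * α x) • S.φ x (X x)) := by
    linear_combination (norm := module) h3 + h4
  exact smul_right_injective _ (two_ne_zero : (2 : ℝ) ≠ 0) h7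

/-- On an almost `α`-paracosymplectic manifold `∇_X ξ = α (X - η(X) ξ) + φhX`. -/
theorem IsAlmostParacosymplectic.leviCivita_ξ (hS : S.IsAlmostParacosymplectic α) (x : M)
    (v : TangentSpace I x) :
    S.g.leviCivita S.ξ x v = α x • (v - S.η x v • S.ξ x) + S.φh x v := by
  obtain ⟨X, hX, rfl⟩ : ∃ X : Π x : M, TangentSpace I x, SmoothFieldAt X x ∧ X x = v :=
    ⟨FiberBundle.extend E v, FiberBundle.contMDiffAt_extend .., by simp⟩
  have hX' : MDiffAt (T% X) x := ContMDiffAt.mdifferentiableAt hX (by simp)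
  have hξ := S.ξ_mdifferentiableAt x
  have h1 := hS.nabla_ξ_φ hX
  have h2 := hS.φ_nabla_ξ hX
  -- [ξ, φX] - φ[ξ, X] = (∇_ξ φ)X - ∇_{φX} ξ + φ∇_X ξ. The first term vanishes and `h2` eliminates
  -- ∇_{φX} ξ.
  have h3 : S.lieDeriv_φ x (X x) = (2 : ℝ) • S.φ x (S.g.nabla X S.ξ x)
      - (2 : ℝ) • (α x • S.φ x (X x)) := by
    rw [S.lieDeriv_φ_apply hX', ← S.g.nabla_torsion_free hξ (S.φ_mdifferentiableAt hX'),
      ← S.g.nabla_torsion_free hξ hX', map_sub]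
    linear_combination (norm := module) h1 - (2 : ℝ) • h2
  have h4 : S.φh x (X x) = S.φ x ((1 / 2 : ℝ) • S.lieDeriv_φ x (X x)) := rfl
  have h5 : S.φ x (S.φ x (S.g.nabla X S.ξ x)) = S.g.nabla X S.ξ x := by
    rw [S.φ_sq, η_nabla_ξ hX', zero_smul, sub_zero]
  change S.g.nabla X S.ξ x = _
  rw [h4, h3, ← S.φ_sq]
  simp only [map_smul, map_sub, h5]
  module

/-- The tensor h is defined point by point, so its regularity has to be read off from Lie brackets
of fields. A bracket costs one derivative, so C² input suffices. -/
theorem φh_mdifferentiableAt {Y : Π x : M, TangentSpace I x} (hY : SmoothField Y) (x : M) :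
    MDiffAt (T% (fun p ↦ S.φh p (Y p) : Π x : M, TangentSpace I x)) x := by
  have hY' (p : M) : MDiffAt (T% Y) p := (hY p).mdifferentiableAt (by simp)
  have h2 : ((2 : ℕ∞) : ℕ∞ω) ≤ ∞ := by exact_mod_cast le_top
  have h3 : ((2 : ℕ∞) : ℕ∞ω) + 1 ≤ ∞ := by exact_mod_cast (le_top : (3 : ℕ∞) ≤ ⊤)
  have : IsManifold I (((2 : ℕ∞) : ℕ∞ω) + 1) M := IsManifold.of_le h3
  have : IsManifold I (minSmoothness ℝ 2) M := by
    rw [minSmoothness_of_isRCLikeNormedField]; exact IsManifold.of_le h2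
  have hm : minSmoothness ℝ (((1 : ℕ∞) : ℕ∞ω) + 1) ≤ (2 : ℕ∞) := by
    rw [minSmoothness_of_isRCLikeNormedField]; norm_num
  have hb {Z : Π x : M, TangentSpace I x} (hZ : CMDiffAt (2 : ℕ∞) (T% Z) x) :
      MDiffAt (T% (mlieBracket I S.ξ Z)) x :=
    (ContMDiffAt.mlieBracket_vectorField (m := (1 : ℕ∞)) (n := (2 : ℕ∞))
      (S.ξ_smooth.contMDiffAt.of_le h2) hZ hm).mdifferentiableAt (by simp)
  have hY2 : CMDiffAt (2 : ℕ∞) (T% Y) x := (hY x).of_le h2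
  have e (p : M) : S.φh p (Y p) = S.φ p (((fun _ : M ↦ (1 / 2 : ℝ)) •
      (mlieBracket I S.ξ (fun p ↦ S.φ p (Y p)) - fun p ↦ S.φ p (mlieBracket I S.ξ Y p))) p) := by
    change S.φ p ((1 / 2 : ℝ) • S.lieDeriv_φ p (Y p)) = _
    rw [S.lieDeriv_φ_apply (hY' p)]
    rfl
  have h4 := S.φ_mdifferentiableAt ((mdifferentiableAt_const (c := (1 / 2 : ℝ))).smul_section
    (mdifferentiableAt_sub_section (hb (S.φ_smoothAt hY2 h2)) (S.φ_mdifferentiableAt (hb hY2))))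
  simpa only [e] using h4

/-- The curvature identity for `R(X, Y)ξ` on an almost `α`-paracosymplectic manifold. -/
theorem IsAlmostParacosymplectic.curvature_ξ (hS : S.IsAlmostParacosymplectic α)
    {X Y : Π x : M, TangentSpace I x} (hX : SmoothField X) (hY : SmoothField Y) (x : M) :
    S.g.curvature X Y S.ξ x =
      mvfderiv I α x (X x) • (Y x - S.η x (Y x) • S.ξ x)
      - mvfderiv I α x (Y x) • (X x - S.η x (X x) • S.ξ x)
      + (α x * S.η x (X x)) • (α x • Y x + S.φh x (Y x))
      - (α x * S.η x (Y x)) • (α x • X x + S.φh x (X x))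
      + S.g.nablaEnd S.φh X Y x - S.g.nablaEnd S.φh Y X x := by
  have hξ := S.ξ_mdifferentiableAt x
  have hα : MDiffAt α x := (hS.smooth x).mdifferentiableAt (by simp)
  -- Leibniz rule for ∇_X (α(Y - η(Y)ξ) + φhY), with ∇_X ξ substituted once more; that substitution
  -- produces the terms quadratic in α and those in α φh.
  have key {X Y : Π x : M, TangentSpace I x} (hY : SmoothField Y) :
      S.g.nabla X (S.g.nabla Y S.ξ) x =
        mvfderiv I α x (X x) • (Y x - S.η x (Y x) • S.ξ x)
        + α x • (S.g.nabla X Y x - mvfderiv I (fun p ↦ S.η p (Y p)) x (X x) • S.ξ x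
          - S.η x (Y x) • (α x • (X x - S.η x (X x) • S.ξ x) + S.φh x (X x)))
        + S.g.nabla X (fun p ↦ S.φh p (Y p)) x := by
    have hY' : MDiffAt (T% Y) x := (hY x).mdifferentiableAt (by simp)
    have e : S.g.nabla Y S.ξ =
        (α • (Y + (fun p ↦ -S.η p (Y p)) • S.ξ)) + fun p ↦ S.φh p (Y p) := by
      funext p
      simp only [PseudoRiemannianMetric.nabla, hS.leviCivita_ξ, Pi.add_apply, Pi.smul_apply',
        neg_smul, sub_eq_add_neg]
    have h4 : MDiffAt (fun p ↦ -S.η p (Y p)) x := (S.η_mdifferentiableAt hY').neg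
    have h5 : mvfderiv I (fun p ↦ -S.η p (Y p)) x = - mvfderiv I (fun p ↦ S.η p (Y p)) x :=
      mvfderiv_neg
    have h6 : MDiffAt (T% ((fun p ↦ -S.η p (Y p)) • S.ξ)) x := h4.smul_section hξ
    have h7 : MDiffAt (T% (Y + (fun p ↦ -S.η p (Y p)) • S.ξ)) x :=
      mdifferentiableAt_add_section hY' h6
    have hc := S.g.leviCivita.isCovariantDerivativeOnUniv
    rw [e, PseudoRiemannianMetric.nabla, hc.add (hα.smul_section h7) (φh_mdifferentiableAt hY x),
      hc.leibniz h7 hα, hc.add hY' h6, hc.leibniz hξ h4, h5]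
    simp only [add_apply, smul_apply, ContinuousLinearMap.smulRight_apply, neg_apply,
      hS.leviCivita_ξ, PseudoRiemannianMetric.nabla, Pi.add_apply, Pi.smul_apply']
    module
  have hX' : MDiffAt (T% X) x := (hX x).mdifferentiableAt (by simp)
  have hY' : MDiffAt (T% Y) x := (hY x).mdifferentiableAt (by simp)
  have h1 := hS.closed x X Y (hX x) (hY x)
  rw [extDerivOne, ← S.g.nabla_torsion_free hX' hY', map_sub] at h1
  -- Closedness of η trades Y(η(X)) for X(η(Y)), so that the derivatives of η(X) and η(Y) cancel in
  -- the curvature.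
  have h2 : mvfderiv I (fun p ↦ S.η p (X p)) x (Y x) =
    mvfderiv I (fun p ↦ S.η p (Y p)) x (X x) -
      (S.η x (S.g.nabla X Y x) - S.η x (S.g.nabla Y X x)) := by linarith
  have h3 : S.g.nabla (mlieBracket I X Y) S.ξ x =
      S.g.leviCivita S.ξ x (S.g.nabla X Y x - S.g.nabla Y X x) := by
    rw [S.g.nabla_torsion_free hX' hY']; rfl
  simp only [PseudoRiemannianMetric.curvature, Pi.sub_apply, key hX, key hY, h3,
    hS.leviCivita_ξ, PseudoRiemannianMetric.nablaEnd, map_sub, h2]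
  module

end Connection

end AlmostParacontactMetricStructure

end Paracontact

/-! ### Commuting coordinate fields and symmetry of second partial derivatives. -/

section Coordinate

variable {E : Type*} [NormedAddCommGroup E] [NormedSpace ℝ E] [CompleteSpace E]
  {H : Type*} [TopologicalSpace H] (I : ModelWithCorners ℝ E H) [I.Boundaryless]
  {M : Type*} [TopologicalSpace M] [ChartedSpace H M] [IsManifold I ∞ M]

/-- The constant vector field on a normed space. -/
def constField (v : E) : Π x : E, TangentSpace 𝓘(ℝ, E) x := fun _ ↦ v

theorem constField_contMDiff (v : E) : CMDiff ∞ (T% (constField v)) := by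
  rw [contMDiff_vectorSpace_iff_contDiff]
  exact contDiff_const

/-- The vector field near `x₀` which is constant, equal to `v`, in the chart at `x₀`. -/
def coordField (x₀ : M) (v : E) : Π x : M, TangentSpace I x :=
  mpullback I 𝓘(ℝ, E) (extChartAt I x₀) (constField v)

theorem coordField_smoothAt {x₀ x : M} (hx : x ∈ (extChartAt I x₀).source) (v : E) :
    SmoothFieldAt (coordField I x₀ v) x :=
  ContMDiffAt.mpullback_vectorField_preimage (n := ∞) (constField_contMDiff v _)
    (contMDiffAt_extChartAt' (by simpa using hx)) (isInvertible_mfderiv_extChartAt hx) (by simp)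

/-- Pullback by the chart commutes with brackets, and constant fields commute. The bracket terms
therefore disappear from dη and dΦ. -/
theorem mlieBracket_coordField {x₀ x : M} (hx : x ∈ (extChartAt I x₀).source) (v w : E) :
    mlieBracket I (coordField I x₀ v) (coordField I x₀ w) x = 0 := by
  have h2 : (2 : ℕ∞ω) ≤ ∞ := (WithTop.coe_le_coe.2 le_top : ((2 : ℕ∞) : ℕ∞ω) ≤ ∞)
  have : IsManifold I (minSmoothness ℝ 2) M := by
    rw [minSmoothness_of_isRCLikeNormedField]
    exact IsManifold.of_le h2
  have h3 := mpullback_mlieBracket (n := ∞) (f := extChartAt I x₀) (x₀ := x)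
    ((constField_contMDiff v _).mdifferentiableAt (by simp))
    ((constField_contMDiff w _).mdifferentiableAt (by simp))
    (contMDiffAt_extChartAt' (I := I) (n := ∞) (by simpa using hx))
    (by rwa [minSmoothness_of_isRCLikeNormedField])
  have h4 : mlieBracket 𝓘(ℝ, E) (constField v) (constField w) = 0 := by
    rw [← mlieBracketWithin_univ, mlieBracketWithin_eq_lieBracketWithin]
    funext y
    change fderivWithin ℝ (fun _ : E ↦ w) Set.univ y v
      - fderivWithin ℝ (fun _ : E ↦ v) Set.univ y w = 0
    simp
  rw [h4, mpullback_zero] at h3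
  exact h3.symm

theorem exists_coordField_eq (x₀ : M) (v : TangentSpace I x₀) :
    ∃ w : E, coordField I x₀ w x₀ = v :=
  ⟨mfderiv% (extChartAt I x₀) x₀ v,
    (isInvertible_mfderiv_extChartAt (mem_extChartAt_source x₀)).inverse_apply_self v⟩

variable {I}

theorem mvfderiv_comp_extChartAt {x₀ x : M} (hx : x ∈ (extChartAt I x₀).source) (v : E)
    {G : E → ℝ} (hG : DifferentiableAt ℝ G (extChartAt I x₀ x)) :
    mvfderiv I (G ∘ extChartAt I x₀) x (coordField I x₀ v x) = fderiv ℝ G (extChartAt I x₀ x) v := by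
  rw [mvfderiv_comp_apply x hG.mdifferentiableAt
    (mdifferentiableAt_extChartAt (by simpa using hx)), coordField, mpullback_apply,
    (isInvertible_mfderiv_extChartAt hx).self_apply_inverse, mvfderiv, mfderiv_eq_fderiv]
  rfl

theorem eventuallyEq_comp_extChartAt {x₀ x : M} (hx : x ∈ (extChartAt I x₀).source) (F : M → ℝ) :
    F =ᶠ[𝓝 x] (F ∘ (extChartAt I x₀).symm) ∘ extChartAt I x₀ := by
  filter_upwards [(isOpen_extChartAt_source (I := I) x₀).mem_nhds hx] with y hy
  exact congrArg F ((extChartAt I x₀).left_inv hy).symm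

theorem mvfderiv_congr {x : M} {F G : M → ℝ} (h : F =ᶠ[𝓝 x] G) (v : TangentSpace I x) :
    mvfderiv I F x v = mvfderiv I G x v := by
  have h1 : mfderiv I 𝓘(ℝ) F x = mfderiv I 𝓘(ℝ) G x := h.mfderiv_eq
  exact congrArg (fun A : TangentSpace I x →L[ℝ] ℝ ↦ A v) h1

theorem contDiffAt_comp_extChartAt_symm {x₀ : M} {F : M → ℝ} (hF : CMDiffAt ∞ F x₀) :
    ContDiffAt ℝ ∞ (F ∘ (extChartAt I x₀).symm) (extChartAt I x₀ x₀) := by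
  have h1 := (contMDiffOn_extChartAt_symm (n := ∞) x₀).contMDiffAt
    (extChartAt_target_mem_nhds (I := I) x₀)
  refine ContMDiffAt.contDiffAt (ContMDiffAt.comp _ ?_ h1)
  rwa [extChartAt_to_inv]

variable (I) in
/-- The partial derivative in the direction `v` in the chart at `x₀`. -/
def coordDeriv (x₀ : M) (v : E) (F : M → ℝ) (x : M) : ℝ :=
  mvfderiv I F x (coordField I x₀ v x)

theorem coordDeriv_congr {x₀ : M} {F G : M → ℝ} (v : E) (h : F =ᶠ[𝓝 x₀] G) :
    coordDeriv I x₀ v F x₀ = coordDeriv I x₀ v G x₀ :=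
  mvfderiv_congr h _

theorem coordDeriv_add {x₀ x : M} {F G : M → ℝ} (v : E) (hF : MDiffAt F x) (hG : MDiffAt G x) :
    coordDeriv I x₀ v (fun p ↦ F p + G p) x = coordDeriv I x₀ v F x + coordDeriv I x₀ v G x := by
  simp only [coordDeriv, mvfderiv_fun_add hF hG, add_apply]

theorem coordDeriv_neg {x₀ x : M} {F : M → ℝ} (v : E) :
    coordDeriv I x₀ v (fun p ↦ -F p) x = -coordDeriv I x₀ v F x := by
  have h : mvfderiv I (fun p ↦ -F p) x = -mvfderiv I F x := mvfderiv_neg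
  simp only [coordDeriv, h, neg_apply]

theorem coordDeriv_sub {x₀ x : M} {F G : M → ℝ} (v : E) (hF : MDiffAt F x) (hG : MDiffAt G x) :
    coordDeriv I x₀ v (fun p ↦ F p - G p) x = coordDeriv I x₀ v F x - coordDeriv I x₀ v G x := by
  have h : mvfderiv I (fun p ↦ F p - G p) x = mvfderiv I F x - mvfderiv I G x := mvfderiv_sub hF hG
  simp only [coordDeriv, h, sub_apply]

theorem coordDeriv_mul {x₀ x : M} {F G : M → ℝ} (v : E) (hF : MDiffAt F x) (hG : MDiffAt G x) :
    coordDeriv I x₀ v (fun p ↦ F p * G p) x =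
      F x * coordDeriv I x₀ v G x + G x * coordDeriv I x₀ v F x := by
  simp only [coordDeriv, mvfderiv_fun_mul hF hG, add_apply, smul_apply, smul_eq_mul]

/-- The chart expression is needed on a neighbourhood, not just at x₀, in order to be differentiated
again. -/
theorem coordDeriv_eventuallyEq {x₀ : M} (v : E) {F : M → ℝ} (hF : CMDiffAt ∞ F x₀) :
    coordDeriv I x₀ v F =ᶠ[𝓝 x₀]
      (fun y ↦ fderiv ℝ (F ∘ (extChartAt I x₀).symm) y v) ∘ extChartAt I x₀ := by
  have h1 : ∀ᶠ y in 𝓝 (extChartAt I x₀ x₀),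
      ContDiffAt ℝ 1 (F ∘ (extChartAt I x₀).symm) y :=
    ((contDiffAt_comp_extChartAt_symm hF).of_le
      (by exact_mod_cast (le_top : (1 : ℕ∞) ≤ ⊤))).eventually (by simp)
  filter_upwards [(continuousAt_extChartAt x₀).eventually h1,
    (isOpen_extChartAt_source (I := I) x₀).mem_nhds (mem_extChartAt_source x₀)] with x hx hx'
  rw [coordDeriv, mvfderiv_congr (eventuallyEq_comp_extChartAt hx' F),
    mvfderiv_comp_extChartAt hx' v (hx.differentiableAt (by simp))]
  rfl

theorem coordDeriv_smoothAt {x₀ : M} (v : E) {F : M → ℝ} (hF : CMDiffAt ∞ F x₀) :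
    CMDiffAt ∞ (coordDeriv I x₀ v F) x₀ := by
  refine ContMDiffAt.congr_of_eventuallyEq ?_ (coordDeriv_eventuallyEq v hF)
  have h1 : ContDiffAt ℝ ∞ (fderiv ℝ (F ∘ (extChartAt I x₀).symm)) (extChartAt I x₀ x₀) :=
    (contDiffAt_comp_extChartAt_symm hF).fderiv_right (by simp)
  exact ContMDiffAt.comp _ (h1.clm_apply contDiffAt_const).contMDiffAt contMDiffAt_extChartAt

theorem coordDeriv_coordField {x₀ : M} (v w : E) {F : M → ℝ} (hF : CMDiffAt ∞ F x₀) :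
    coordDeriv I x₀ w (coordDeriv I x₀ v F) x₀ =
      fderiv ℝ (fderiv ℝ (F ∘ (extChartAt I x₀).symm)) (extChartAt I x₀ x₀) w v := by
  have h1 : ContDiffAt ℝ ∞ (fderiv ℝ (F ∘ (extChartAt I x₀).symm)) (extChartAt I x₀ x₀) :=
    (contDiffAt_comp_extChartAt_symm hF).fderiv_right (by simp)
  have h2 := h1.differentiableAt (by simp)
  rw [coordDeriv, mvfderiv_congr (coordDeriv_eventuallyEq v hF), mvfderiv_comp_extChartAt
    (mem_extChartAt_source x₀) w (h2.clm_apply (differentiableAt_const _)),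
    fderiv_clm_apply h2 (differentiableAt_const _)]
  simp

theorem coordDeriv_comm {x₀ : M} (v w : E) {F : M → ℝ} (hF : CMDiffAt ∞ F x₀) :
    coordDeriv I x₀ w (coordDeriv I x₀ v F) x₀ =
      coordDeriv I x₀ v (coordDeriv I x₀ w F) x₀ := by
  rw [coordDeriv_coordField v w hF, coordDeriv_coordField w v hF]
  refine (contDiffAt_comp_extChartAt_symm hF).isSymmSndFDerivAt ?_ w v
  rw [minSmoothness_of_isRCLikeNormedField]
  exact (WithTop.coe_le_coe.2 le_top : ((2 : ℕ∞) : ℕ∞ω) ≤ ∞)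

end Coordinate

/-! ### Exterior differentiation of dΦ = 2α η ∧ Φ and the shape of dα. -/

section Paracontact

variable {E : Type*} [NormedAddCommGroup E] [NormedSpace ℝ E]
  {H : Type*} [TopologicalSpace H] {I : ModelWithCorners ℝ E H}
  {M : Type*} [TopologicalSpace M] [ChartedSpace H M] [IsManifold I ∞ M] {n : ℕ}

namespace AlmostParacontactMetricStructure

variable (S : AlmostParacontactMetricStructure I M n)

/-- The component `η(∂ᵥ)` in the chart at `x₀`. -/
def etaComp (x₀ : M) (v : E) (p : M) : ℝ := S.η p (coordField I x₀ v p)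

/-- The component `Φ(∂ᵥ, ∂_w)` in the chart at `x₀`. -/
def formComp (x₀ : M) (v w : E) (p : M) : ℝ :=
  S.fundamentalForm p (coordField I x₀ v p) (coordField I x₀ w p)

variable {S} {α : M → ℝ} [FiniteDimensional ℝ E] [I.Boundaryless]

theorem etaComp_smoothAt {x₀ x : M} (hx : x ∈ (extChartAt I x₀).source) (v : E) :
    CMDiffAt ∞ (S.etaComp x₀ v) x := by
  have : CompleteSpace E := FiniteDimensional.complete ℝ E
  exact S.η_smoothAt (coordField_smoothAt I hx v)

theorem formComp_smoothAt {x₀ x : M} (hx : x ∈ (extChartAt I x₀).source) (v w : E) :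
    CMDiffAt ∞ (S.formComp x₀ v w) x := by
  have : CompleteSpace E := FiniteDimensional.complete ℝ E
  exact S.fundamentalForm_smoothAt (coordField_smoothAt I hx v) (coordField_smoothAt I hx w)

theorem formComp_swap (x₀ : M) (v w : E) :
    S.formComp x₀ v w = fun p ↦ -S.formComp x₀ w v p :=
  funext fun p ↦ S.fundamentalForm_swap p _ _

theorem IsAlmostParacosymplectic.coordDeriv_etaComp (hS : S.IsAlmostParacosymplectic α)
    {x₀ x : M} (hx : x ∈ (extChartAt I x₀).source) (v w : E) :
    coordDeriv I x₀ v (S.etaComp x₀ w) x = coordDeriv I x₀ w (S.etaComp x₀ v) x := by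
  have : CompleteSpace E := FiniteDimensional.complete ℝ E
  have h := hS.closed x _ _ (coordField_smoothAt I hx v) (coordField_smoothAt I hx w)
  rw [extDerivOne, mlieBracket_coordField I hx, map_zero] at h
  change mvfderiv I (fun p ↦ S.η p (coordField I x₀ w p)) x (coordField I x₀ v x) =
    mvfderiv I (fun p ↦ S.η p (coordField I x₀ v p)) x (coordField I x₀ w x)
  linarith

theorem IsAlmostParacosymplectic.coordDeriv_formComp (hS : S.IsAlmostParacosymplectic α)
    {x₀ x : M} (hx : x ∈ (extChartAt I x₀).source) (u v w : E) :
    coordDeriv I x₀ u (S.formComp x₀ v w) x - coordDeriv I x₀ v (S.formComp x₀ u w) x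
        + coordDeriv I x₀ w (S.formComp x₀ u v) x =
      2 * (α x * (S.etaComp x₀ u x * S.formComp x₀ v w x - S.etaComp x₀ v x * S.formComp x₀ u w x
        + S.etaComp x₀ w x * S.formComp x₀ u v x)) := by
  have : CompleteSpace E := FiniteDimensional.complete ℝ E
  have h := hS.extDeriv_fundamentalForm x _ _ _ (coordField_smoothAt I hx u)
    (coordField_smoothAt I hx v) (coordField_smoothAt I hx w)
  rw [extDerivTwo, wedgeOneTwo, mlieBracket_coordField I hx, mlieBracket_coordField I hx,
    mlieBracket_coordField I hx] at h
  simp only [map_zero, zero_apply, sub_zero] at h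
  have h1 : (1 / 3 : ℝ) * (coordDeriv I x₀ u (S.formComp x₀ v w) x
      + coordDeriv I x₀ v (S.formComp x₀ w u) x + coordDeriv I x₀ w (S.formComp x₀ u v) x) =
      2 * α x * ((1 / 3) * (S.etaComp x₀ u x * S.formComp x₀ v w x
        + S.etaComp x₀ v x * S.formComp x₀ w u x
        + S.etaComp x₀ w x * S.formComp x₀ u v x)) := h
  rw [formComp_swap x₀ w u, coordDeriv_neg] at h1
  linear_combination 3 * h1

/-- The partial derivatives of the components of `dΦ = 2α η ∧ Φ`. -/
theorem IsAlmostParacosymplectic.coordDeriv_coordDeriv_formComp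
    (hS : S.IsAlmostParacosymplectic α) (x₀ : M) (t u v w : E) :
    coordDeriv I x₀ t (coordDeriv I x₀ u (S.formComp x₀ v w)) x₀
        - coordDeriv I x₀ t (coordDeriv I x₀ v (S.formComp x₀ u w)) x₀
        + coordDeriv I x₀ t (coordDeriv I x₀ w (S.formComp x₀ u v)) x₀ =
      2 * (coordDeriv I x₀ t α x₀ * (S.etaComp x₀ u x₀ * S.formComp x₀ v w x₀
          - S.etaComp x₀ v x₀ * S.formComp x₀ u w x₀ + S.etaComp x₀ w x₀ * S.formComp x₀ u v x₀)
        + α x₀ * (coordDeriv I x₀ t (S.etaComp x₀ u) x₀ * S.formComp x₀ v w x₀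
          - coordDeriv I x₀ t (S.etaComp x₀ v) x₀ * S.formComp x₀ u w x₀
          + coordDeriv I x₀ t (S.etaComp x₀ w) x₀ * S.formComp x₀ u v x₀
          + S.etaComp x₀ u x₀ * coordDeriv I x₀ t (S.formComp x₀ v w) x₀
          - S.etaComp x₀ v x₀ * coordDeriv I x₀ t (S.formComp x₀ u w) x₀
          + S.etaComp x₀ w x₀ * coordDeriv I x₀ t (S.formComp x₀ u v) x₀)) := by
  have : CompleteSpace E := FiniteDimensional.complete ℝ E
  have hx := mem_extChartAt_source (I := I) x₀
  have hα : MDiffAt α x₀ := (hS.smooth x₀).mdifferentiableAt (by simp)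
  have hη (a : E) : MDiffAt (S.etaComp x₀ a) x₀ :=
    (etaComp_smoothAt hx a).mdifferentiableAt (by simp)
  have hΦ (a b : E) : MDiffAt (S.formComp x₀ a b) x₀ :=
    (formComp_smoothAt hx a b).mdifferentiableAt (by simp)
  have hD (a b c : E) : MDiffAt (coordDeriv I x₀ a (S.formComp x₀ b c)) x₀ :=
    (coordDeriv_smoothAt a (formComp_smoothAt hx b c)).mdifferentiableAt (by simp)
  have hp (a b c : E) : MDiffAt (fun p ↦ S.etaComp x₀ a p * S.formComp x₀ b c p) x₀ :=
    (hη a).mul (hΦ b c)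
  have hs : MDiffAt (fun p ↦ S.etaComp x₀ u p * S.formComp x₀ v w p
      - S.etaComp x₀ v p * S.formComp x₀ u w p) x₀ := (hp u v w).sub (hp v u w)
  have ht : MDiffAt (fun p ↦ S.etaComp x₀ u p * S.formComp x₀ v w p
      - S.etaComp x₀ v p * S.formComp x₀ u w p + S.etaComp x₀ w p * S.formComp x₀ u v p) x₀ :=
    hs.add (hp w u v)
  -- The component identity holds on the whole chart domain, which is what permits differentiating
  -- it at x₀.
  have he : (fun p ↦ coordDeriv I x₀ u (S.formComp x₀ v w) p
        - coordDeriv I x₀ v (S.formComp x₀ u w) p + coordDeriv I x₀ w (S.formComp x₀ u v) p)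
      =ᶠ[𝓝 x₀] fun p ↦ 2 * (α p * (S.etaComp x₀ u p * S.formComp x₀ v w p
        - S.etaComp x₀ v p * S.formComp x₀ u w p + S.etaComp x₀ w p * S.formComp x₀ u v p)) := by
    filter_upwards [(isOpen_extChartAt_source (I := I) x₀).mem_nhds hx] with p hp
    exact hS.coordDeriv_formComp hp u v w
  have hd : MDiffAt (fun p ↦ coordDeriv I x₀ u (S.formComp x₀ v w) p
      - coordDeriv I x₀ v (S.formComp x₀ u w) p) x₀ := (hD u v w).sub (hD v u w)
  have hm : MDiffAt (fun p ↦ α p * (S.etaComp x₀ u p * S.formComp x₀ v w p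
      - S.etaComp x₀ v p * S.formComp x₀ u w p + S.etaComp x₀ w p * S.formComp x₀ u v p)) x₀ :=
    hα.mul ht
  have h := coordDeriv_congr (I := I) t he
  have hc : coordDeriv I x₀ t (fun _ ↦ (2 : ℝ)) x₀ = 0 := by
    rw [coordDeriv, mvfderiv_const, zero_apply]
  rw [coordDeriv_add t hd (hD w u v),
    coordDeriv_sub t (hD u v w) (hD v u w), coordDeriv_mul t mdifferentiableAt_const hm,
    coordDeriv_mul t hα ht, coordDeriv_add t hs (hp w u v), coordDeriv_sub t (hp u v w) (hp v u w),
    coordDeriv_mul t (hη u) (hΦ v w), coordDeriv_mul t (hη v) (hΦ u w),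
    coordDeriv_mul t (hη w) (hΦ u v), hc] at h
  linear_combination h

/-- `dα ∧ η ∧ Φ = 0`, contracted with `ξ` and restricted to `ker η`. -/
theorem IsAlmostParacosymplectic.mvfderiv_wedge_fundamentalForm
    (hS : S.IsAlmostParacosymplectic α) (x : M) (u v w : TangentSpace I x)
    (hu : S.η x u = 0) (hv : S.η x v = 0) (hw : S.η x w = 0) :
    mvfderiv I α x u * S.fundamentalForm x v w - mvfderiv I α x v * S.fundamentalForm x u w
      + mvfderiv I α x w * S.fundamentalForm x u v = 0 := by
  have : CompleteSpace E := FiniteDimensional.complete ℝ E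
  have hx := mem_extChartAt_source (I := I) x
  obtain ⟨a, rfl⟩ := exists_coordField_eq I x u
  obtain ⟨b, rfl⟩ := exists_coordField_eq I x v
  obtain ⟨c, rfl⟩ := exists_coordField_eq I x w
  -- The coordinate field of d agrees with ξ only at x, and those of a, b, c lie in ker η only at x;
  -- the derivatives of their η-components need not vanish there.
  obtain ⟨d, hd⟩ := exists_coordField_eq I x (S.ξ x)
  have ha' : S.etaComp x a x = 0 := hu
  have hb' : S.etaComp x b x = 0 := hv
  have hc' : S.etaComp x c x = 0 := hw
  have hd' : S.etaComp x d x = 1 := by rw [etaComp, hd, S.η_ξ]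
  have hF (e : E) : S.formComp x e d x = 0 := by rw [formComp, hd, S.fundamentalForm_ξ]
  -- This says dΦ(a, b, c) = 0, as η vanishes on all three; it disposes of the term α η(ξ) dΦ(a, b,
  -- c).
  have h0 := hS.coordDeriv_formComp hx a b c
  have h1 := hS.coordDeriv_coordDeriv_formComp x a b c d
  have h2 := hS.coordDeriv_coordDeriv_formComp x b a c d
  have h3 := hS.coordDeriv_coordDeriv_formComp x c a b d
  have h4 := hS.coordDeriv_coordDeriv_formComp x d a b c
  -- The symmetric quantities ∂_p η_q and ∂_p ∂_q Φ_rs are brought to one order, so that the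
  -- alternating sum of `h1`, ..., `h4`, which is d(dΦ), cancels formally.
  rw [hS.coordDeriv_etaComp hx a d, hS.coordDeriv_etaComp hx a b,
    hS.coordDeriv_etaComp hx a c] at h1
  rw [hS.coordDeriv_etaComp hx b d, hS.coordDeriv_etaComp hx b c] at h2
  rw [hS.coordDeriv_etaComp hx c d] at h3
  have hcomm (p q r s : E) := coordDeriv_comm p q (formComp_smoothAt (S := S) hx r s)
  rw [hcomm b a, hcomm c a, hcomm d a] at h1
  rw [hcomm c b, hcomm d b] at h2
  rw [hcomm d c] at h3
  simp only [ha', hb', hc', hd', hF] at h0 h1 h2 h3 h4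
  change coordDeriv I x a α x * S.formComp x b c x - coordDeriv I x b α x * S.formComp x a c x
    + coordDeriv I x c α x * S.formComp x a b x = 0
  linear_combination (-h1 + h2 - h3 + h4) / 2 - α x * h0

/-- If `n ≥ 2` then `dα = ξ(α) η`. -/
theorem IsAlmostParacosymplectic.mvfderiv_eq (hS : S.IsAlmostParacosymplectic α) (hn : 2 ≤ n)
    (x : M) (v : TangentSpace I x) :
    mvfderiv I α x v = mvfderiv I α x (S.ξ x) * S.η x v := by
  suffices h : ∀ u, S.η x u = 0 → mvfderiv I α x u = 0 by
    have h1 := h (v - S.η x v • S.ξ x) (by simp [S.η_ξ])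
    rw [map_sub, map_smul, smul_eq_mul] at h1
    linarith
  intro u hu
  by_contra hne
  -- Three linear conditions in dimension 2n + 1 > 3 leave a common nonzero solution w; this is
  -- where n ≥ 2 enters. The wedge identity for u, w, z then reads dα(u) Φ(w, z) = 0, contradicting
  -- nondegeneracy on ker η if dα(u) ≠ 0.
  let L : TangentSpace I x →ₗ[ℝ] ℝ × ℝ × ℝ :=
    (mvfderiv I α x).toLinearMap.prod
      ((S.η x).toLinearMap.prod (S.fundamentalForm x u).toLinearMap)
  have hfin : Module.finrank ℝ (TangentSpace I x) = 2 * n + 1 := by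
    obtain ⟨b, -⟩ := S.signature x
    rw [Module.finrank_eq_card_basis b]
    simp
    ring
  have : FiniteDimensional ℝ (TangentSpace I x) := inferInstanceAs (FiniteDimensional ℝ E)
  have hker : L.ker ≠ ⊥ := by
    refine LinearMap.ker_ne_bot_of_finrank_lt ?_
    rw [hfin]
    simp
    omega
  obtain ⟨w, hw, hw0⟩ := (Submodule.ne_bot_iff _).1 hker
  have hL : mvfderiv I α x w = 0 ∧ S.η x w = 0 ∧ S.fundamentalForm x u w = 0 := by
    simpa [L] using hw
  obtain ⟨h1, h2, h3⟩ := hL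
  refine hw0 (S.eq_zero_of_fundamentalForm x w h2 fun z hz ↦ ?_)
  have h4 := hS.mvfderiv_wedge_fundamentalForm x u w z hu h2 hz
  rw [h1, h3, zero_mul, mul_zero, sub_zero, add_zero] at h4
  exact (mul_eq_zero.1 h4).resolve_left hne

end AlmostParacontactMetricStructure

end Paracontact

end ParaGeom

end

theorem mainTheorem2 (n : ℕ) {M : Type*} [TopologicalSpace M]
    [ChartedSpace (EuclideanSpace ℝ (Fin (2 * n + 1))) M] [IsManifold (𝓡 (2 * n + 1)) ∞ M]
    (S : ParaGeom.AlmostParacontactMetricStructure (𝓡 (2 * n + 1)) M n) (α : M → ℝ)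
    (hS : S.IsAlmostParacosymplectic α) :
    (∀ X Y : Π x : M, TangentSpace (𝓡 (2 * n + 1)) x, ParaGeom.SmoothField X → ParaGeom.SmoothField Y →
      ∀ x : M, S.g.curvature X Y S.ξ x =
        mvfderiv (𝓡 (2 * n + 1)) α x (X x) • (Y x - S.η x (Y x) • S.ξ x)
        - mvfderiv (𝓡 (2 * n + 1)) α x (Y x) • (X x - S.η x (X x) • S.ξ x)
        + (α x * S.η x (X x)) • (α x • Y x + S.φh x (Y x))
        - (α x * S.η x (Y x)) • (α x • X x + S.φh x (X x))
        + S.g.nablaEnd S.φh X Y x - S.g.nablaEnd S.φh Y X x) ∧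
    (2 ≤ n → ∀ X Y : Π x : M, TangentSpace (𝓡 (2 * n + 1)) x,
      ParaGeom.SmoothField X → ParaGeom.SmoothField Y →
      ∀ x : M, S.g.curvature X Y S.ξ x =
        (mvfderiv (𝓡 (2 * n + 1)) α x (S.ξ x) + α x ^ 2) •
          (S.η x (X x) • Y x - S.η x (Y x) • X x)
        + α x • (S.η x (X x) • S.φh x (Y x) - S.η x (Y x) • S.φh x (X x))
        + S.g.nablaEnd S.φh X Y x - S.g.nablaEnd S.φh Y X x) := by
  refine ⟨fun X Y hX hY x ↦ hS.curvature_ξ hX hY x, fun hn X Y hX hY x ↦ ?_⟩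
  -- With dα = f η the two terms f η(X) η(Y) ξ cancel by symmetry.
  rw [hS.curvature_ξ hX hY x, hS.mvfderiv_eq hn x (X x), hS.mvfderiv_eq hn x (Y x)]
  module
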